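/- Let $n\ge 0$, let $h:\mathbb R^n\to(-\infty,\infty]$ be proper, lower semicontinuous and convex, and let $\operatorname{dom}h=\{x: h(x)<\infty\}$. Let $f_1,\dots,f_k$ and $f_1',\dots,f_k'$ be real-valued functions that are differentiable at every point of $\operatorname{dom} h$ (no Lipschitz, smoothness or convexity condition is imposed on them), and suppose that there is an index $i^*\in\{1,\dots,k\}$ with $f_i'=f_i$ for all $i\ne i^*$. For a proper, lower semicontinuous, convex $\psi:\mathbb R^n\to(-\infty,\infty]$ let $\operatorname{prox}_\psi(z)=\operatorname{argmin}_{x\in\mathbb R^n}\{\psi(x)+\tfrac12\|x-z\|^2\}$, and for $C\ge 0$ let $\operatorname{Clip}_C=\operatorname{prox}_{q_C}$, where $q_C(x)=1$ if $\|x\|\le C$ and $q_C(x)=\infty$ otherwise. Let $b\ge 1$ be a batch size that divides $k$, let $\ell=k/b$, let $\lambda>0$, $C\ge 0$, $\sigma>0$, let $X_0\in\operatorname{dom}h$ be a fixed point, and let $N_1,N_2,\dots$ be independent random vectors with law $\mathcal N(0,\sigma^2 I)$. Cyclic clipped DP-SGD on $\{f_i\}$ produces, for $t=1,2,\dots$,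 $$j_t=b(t-1)\bmod k,\qquad B_t=\{j_t+1,\dots,j_t+b\},\qquad g_t=\frac1b\sum_{i\in B_t}\operatorname{Clip}_C(\nabla f_i(X_{t-1})),$$ $$X_t=\operatorname{prox}_{\lambda h}(X_{t-1}-\lambda g_t+N_t).$$ Let $X_t'$ be the iterates produced in the same way from $\{f_i'\}$, with the same $X_0$, $\lambda$, $C$, $b$, $\sigma$ and $\{N_t\}$. For $\alpha>1$ let $D_\alpha(X\|Y)=\frac1{\alpha-1}\log\int\left(\frac{d\mu}{d\nu}\right)^{\alpha}d\nu$ if the law $\mu$ of $X$ is absolutely continuous with respect to the law $\nu$ of $Y$, and $D_\alpha(X\|Y)=\infty$ otherwise. Then, for every $\alpha>1$ and every integer $T\ge\ell$, the iterates $X_T$ and $X_T'$ are random vectors (that is, measurable up to null sets) and $$D_\alpha(X_T\|X_T')\le 8\alpha T\left(\frac{\lambda C}{\sigma}\right)^2 .$$ -/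

import Mathlib

open MeasureTheory ProbabilityTheory

noncomputable section

namespace DPSGD

/-- `ℝⁿ` with the Euclidean norm. -/
abbrev E (n : ℕ) : Type := EuclideanSpace ℝ (Fin n)

/-- The effective domain `{x | ψ x < ∞}` of an extended-real-valued function. -/
def dom {n : ℕ} (ψ : E n → EReal) : Set (E n) := {x | ψ x < ⊤}

/-- Proper, lower semicontinuous, convex functions `ℝⁿ → (-∞, ∞]`. -/
structure IsProperLscConvex {n : ℕ} (ψ : E n → EReal) : Prop where
  ne_bot : ∀ x, ψ x ≠ ⊥
  dom_nonempty : (dom ψ).Nonempty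
  lsc : LowerSemicontinuous ψ
  convex : ∀ x y : E n, ∀ a b : ℝ, 0 < a → 0 < b → a + b = 1 →
    ψ (a • x + b • y) ≤ (a : EReal) * ψ x + (b : EReal) * ψ y

/-- `p` minimizes `x ↦ ψ x + ‖x - z‖² / 2` over `ℝⁿ`. -/
def IsProx {n : ℕ} (ψ : E n → EReal) (z p : E n) : Prop :=
  ∀ x : E n, ψ p + ((1 / 2 * ‖p - z‖ ^ 2 : ℝ) : EReal)
    ≤ ψ x + ((1 / 2 * ‖x - z‖ ^ 2 : ℝ) : EReal)

/-- The proximal operator: the minimizer of `x ↦ ψ x + ‖x - z‖² / 2`, which exists and is unique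
for every proper, lower semicontinuous, convex `ψ`. -/
def prox {n : ℕ} (ψ : E n → EReal) (z : E n) : E n :=
  Classical.epsilon (IsProx ψ z)

open Classical in
/-- The function equal to `1` on the closed ball of radius `C` and to `∞` outside it. -/
def ballFun {n : ℕ} (C : ℝ) (x : E n) : EReal := if ‖x‖ ≤ C then 1 else ⊤

/-- Clipping at norm `C`. -/
def clip {n : ℕ} (C : ℝ) (y : E n) : E n := prox (ballFun C) y

/-- The cyclic batch of step `t ≥ 1`, namely `{j + 1, …, j + b}` with `j = b (t - 1) mod k`.
The element `i : Fin k` stands for the index `i + 1` in `{1, …, k}`. -/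
def batch (k b t : ℕ) : Finset (Fin k) :=
  Finset.univ.filter fun i =>
    b * (t - 1) % k + 1 ≤ (i : ℕ) + 1 ∧ (i : ℕ) + 1 ≤ b * (t - 1) % k + b

/-- The averaged clipped gradient over the batch of step `t`, at the point `x`. -/
def avgClippedGrad {n k : ℕ} (f : Fin k → E n → ℝ) (b : ℕ) (C : ℝ) (t : ℕ) (x : E n) : E n :=
  (1 / (b : ℝ)) • ∑ i ∈ batch k b t, clip C (gradient (f i) x)

/-- The iterates `X₀, X₁, …` of cyclic clipped DP-SGD along a noise sequence `N₁, N₂, …`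
(`N 0` is not used). -/
def iterate {n k : ℕ} (f : Fin k → E n → ℝ) (h : E n → EReal) (b : ℕ) (lam C : ℝ)
    (x₀ : E n) (N : ℕ → E n) : ℕ → E n
  | 0 => x₀
  | t + 1 =>
    prox (fun x => (lam : EReal) * h x)
      (iterate f h b lam C x₀ N t
        - lam • avgClippedGrad f b C (t + 1) (iterate f h b lam C x₀ N t)
        + N (t + 1))

/-- The collections `f` and `f'` agree except possibly at one index. -/
def Neighboring {n k : ℕ} (f f' : Fin k → E n → ℝ) : Prop :=
  ∃ iStar : Fin k, ∀ i, i ≠ iStar → f' i = f i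

open Classical in
/-- The Rényi divergence of order `α > 1`,
`(α - 1)⁻¹ * log ∫ (dμ/dν) ^ α dν` if `μ ≪ ν`, and `∞` otherwise. -/
def renyiDiv {Ω : Type*} [MeasurableSpace Ω] (α : ℝ) (μ ν : Measure Ω) : EReal :=
  if μ ≪ ν then
    ((1 / (α - 1) : ℝ) : EReal) * ENNReal.log (∫⁻ x, (μ.rnDeriv ν x) ^ α ∂ν)
  else ⊤

end DPSGD

end

namespace DPSGD

open scoped RealInnerProductSpace ENNReal

/-! ### The proximal operator -/

/-! Clipping bounds both averaged gradients by `C`, so from a common point the two updates differ,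
before noise, by at most `2 * lam * C`. By Cameron–Martin, shifting the Gaussian noise by such a
vector costs at most `2 * α * (lam * C / σ) ^ 2` in Rényi divergence (`lintegral_shiftDensity_rpow`,
`map_add_gaussianNoise`).

The costs add up over the steps. The moments `∫ g ^ α` multiply when a state is paired with fresh
independent noise whose shift depends on the state (`RenyiMomentLE.prod_map`), and they do not grow
when the pair is mapped to the next iterate (`RenyiMomentLE.map`). Induction gives `2 * α * T * (lam
* C / σ) ^ 2`, within the claimed bound.

The proximal map enters only as measurable post-processing: it exists and is nonexpansive, hence
continuous. -/

theorem IsProx.exists_coe {n : ℕ} {ψ : E n → EReal} (hψ : IsProperLscConvex ψ) {z p : E n}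
    (hp : IsProx ψ z p) : ∃ r : ℝ, ψ p = r := by
  obtain ⟨x₀, hx₀⟩ := hψ.dom_nonempty
  have htop : ψ p ≠ ⊤ := by
    intro h
    have := hp x₀
    rw [h, EReal.top_add_coe, top_le_iff] at this
    exact (EReal.add_lt_top (ne_of_lt hx₀) (EReal.coe_ne_top _)).ne this
  exact ⟨(ψ p).toReal, (EReal.coe_toReal htop (hψ.ne_bot p)).symm⟩

/-- First-order optimality of `p`, tested at a point of the segment towards `q` and divided by `t`.
The `t / 2` term is the second-order error, which vanishes as `t → 0`. -/
theorem IsProx.sub_le {n : ℕ} {ψ : E n → EReal} (hψ : IsProperLscConvex ψ) {z p q : E n}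
    (hp : IsProx ψ z p) {r s : ℝ} (hr : ψ p = r) (hs : ψ q = s) {t : ℝ} (ht0 : 0 < t)
    (ht1 : t < 1) : r - s ≤ ⟪q - p, p - z⟫ + t / 2 * ‖q - p‖ ^ 2 := by
  have h1 := hp ((1 - t) • p + t • q)
  have h2 := hψ.convex p q (1 - t) t (by linarith) ht0 (by ring)
  rw [hr, hs] at h2
  rw [hr] at h1
  have h3 := h1.trans (add_le_add_left h2 _)
  norm_cast at h3
  have h4 : (1 - t) • p + t • q - z = t • (q - p) + (p - z) := by module
  rw [h4, norm_add_sq_real, norm_smul, real_inner_smul_left, mul_pow, Real.norm_eq_abs,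
    sq_abs] at h3
  have h5 : t * (r - s) ≤ t * (⟪q - p, p - z⟫ + t / 2 * ‖q - p‖ ^ 2) := by linarith
  exact le_of_mul_le_mul_left h5 ht0

/-- Proximal points are nonexpansive in the base point. -/
theorem IsProx.norm_sub_le {n : ℕ} {ψ : E n → EReal} (hψ : IsProperLscConvex ψ) {z w p q : E n}
    (hp : IsProx ψ z p) (hq : IsProx ψ w q) : ‖p - q‖ ≤ ‖z - w‖ := by
  obtain ⟨r, hr⟩ := hp.exists_coe hψ
  obtain ⟨s, hs⟩ := hq.exists_coe hψ
  -- Adding the two optimality inequalities cancels `r - s`; Cauchy–Schwarz and division by `‖p -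
  -- q‖` remain.
  have key : ∀ t : ℝ, 0 < t → t < 1 → (1 - t) * ‖p - q‖ ≤ ‖z - w‖ := by
    intro t ht0 ht1
    have h1 := hp.sub_le hψ hr hs ht0 ht1
    have h2 := hq.sub_le hψ hs hr ht0 ht1
    rw [norm_sub_rev q p] at h1
    have h3 : ⟪q - p, p - z⟫ + ⟪p - q, q - w⟫ = ⟪p - q, z - w⟫ - ‖p - q‖ ^ 2 := by
      have e : q - p = -(p - q) := by abel
      have e2 : ‖p - q‖ ^ 2 = ⟪p - q, p - q⟫ := (real_inner_self_eq_norm_sq _).symm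
      rw [e, inner_neg_left, e2, ← inner_neg_right, ← inner_add_right, ← inner_sub_right]
      congr 1
      abel
    have h4 := real_inner_le_norm (p - q) (z - w)
    rcases (norm_nonneg (p - q)).eq_or_lt with h0 | h0
    · rw [← h0, mul_zero]; exact norm_nonneg _
    · have h5 : ‖p - q‖ * ((1 - t) * ‖p - q‖) ≤ ‖p - q‖ * ‖z - w‖ := by nlinarith
      exact le_of_mul_le_mul_left h5 h0
  refine le_of_tendsto (f := fun t : ℝ => (1 - t) * ‖p - q‖)
    (x := nhdsWithin 0 (Set.Ioi 0)) ?_ ?_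
  · have : Filter.Tendsto (fun t : ℝ => (1 - t) * ‖p - q‖) (nhds 0)
        (nhds ((1 - 0) * ‖p - q‖)) := by
      apply Continuous.tendsto; fun_prop
    simpa using this.mono_left nhdsWithin_le_nhds
  · filter_upwards [Ioo_mem_nhdsGT (zero_lt_one' ℝ)] with t ht using key t ht.1 ht.2

/-- The proximal point exists for proper, lower semicontinuous, convex functions. -/
theorem exists_isProx {n : ℕ} {ψ : E n → EReal} (hψ : IsProperLscConvex ψ) (z : E n) :
    ∃ p, IsProx ψ z p := by
  obtain ⟨x₀, hx₀⟩ := hψ.dom_nonempty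
  have hcoe : ∀ x, ψ x ≠ ⊤ → ∃ r : ℝ, ψ x = r := fun x hx =>
    ⟨(ψ x).toReal, (EReal.coe_toReal hx (hψ.ne_bot x)).symm⟩
  obtain ⟨r, hr⟩ := hcoe x₀ (ne_of_lt (show ψ x₀ < ⊤ from hx₀))
  obtain ⟨y, -, hmin⟩ := LowerSemicontinuousOn.exists_isMinOn
    (Metric.nonempty_closedBall.2 zero_le_one) (isCompact_closedBall x₀ 1)
    (hψ.lsc.lowerSemicontinuousOn _)
  have hyr : ψ y ≤ r := hr ▸ hmin (Metric.mem_closedBall_self zero_le_one)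
  obtain ⟨m, hm⟩ := hcoe y (ne_of_lt (hyr.trans_lt (EReal.coe_lt_top r)))
  have hmr : m ≤ r := by rw [hm] at hyr; exact_mod_cast hyr
  -- The segment from `x₀` to `x` meets the unit sphere about `x₀`, where `ψ` is at least `m`;
  -- convexity then limits the decrease of `ψ` to a linear rate.
  have hgrowth : ∀ x, 1 < ‖x - x₀‖ → ∀ s : ℝ, ψ x = s → r - ‖x - x₀‖ * (r - m) ≤ s := by
    intro x hx s hs
    set ρ := ‖x - x₀‖
    have hρ : 0 < ρ := by linarith
    have hρ1 : ρ⁻¹ < 1 := inv_lt_one_of_one_lt₀ hx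
    have h1 := hψ.convex x₀ x (1 - ρ⁻¹) ρ⁻¹ (by linarith) (inv_pos.2 hρ) (by ring)
    have h2 : ψ y ≤ ψ ((1 - ρ⁻¹) • x₀ + ρ⁻¹ • x) := by
      refine hmin (mem_closedBall_iff_norm.2 (le_of_eq ?_))
      have e : (1 - ρ⁻¹) • x₀ + ρ⁻¹ • x - x₀ = ρ⁻¹ • (x - x₀) := by module
      rw [e, norm_smul, Real.norm_of_nonneg (inv_pos.2 hρ).le]
      exact inv_mul_cancel₀ hρ.ne'
    have h3 := h2.trans h1
    rw [hm, hr, hs] at h3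
    norm_cast at h3
    have h4 := mul_le_mul_of_nonneg_left h3 hρ.le
    have h5 : ρ * ((1 - ρ⁻¹) * r + ρ⁻¹ * s) = ρ * r - r + s := by
      field_simp
    linarith
  -- Beyond this radius the quadratic term outweighs the linear decrease, so the objective exceeds
  -- its value at `x₀`; the `1` makes `hgrowth` applicable.
  set R := max 1 (2 * (‖x₀ - z‖ + (r - m)))
  have hlsc : LowerSemicontinuous fun x => ψ x + ((1 / 2 * ‖x - z‖ ^ 2 : ℝ) : EReal) := by
    refine LowerSemicontinuous.add' hψ.lsc (Continuous.lowerSemicontinuous ?_) fun x =>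
      EReal.continuousAt_add (Or.inr (EReal.coe_ne_bot _)) (Or.inr (EReal.coe_ne_top _))
    exact continuous_coe_real_ereal.comp (by fun_prop)
  have hx₀R : x₀ ∈ Metric.closedBall x₀ R :=
    Metric.mem_closedBall_self (zero_le_one.trans (le_max_left _ _))
  obtain ⟨p, -, hp⟩ := LowerSemicontinuousOn.exists_isMinOn ⟨x₀, hx₀R⟩
    (isCompact_closedBall x₀ R) (hlsc.lowerSemicontinuousOn _)
  refine ⟨p, fun x => ?_⟩
  by_cases hx : x ∈ Metric.closedBall x₀ R
  · exact hp hx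
  refine le_trans (hp hx₀R) ?_
  by_cases htop : ψ x = ⊤
  · rw [htop, EReal.top_add_coe]
    exact le_top
  obtain ⟨s, hs⟩ := hcoe x htop
  rw [mem_closedBall_iff_norm, not_le] at hx
  have h1 := hgrowth x ((le_max_left _ _).trans_lt hx) s hs
  have h2 : 2 * (‖x₀ - z‖ + (r - m)) < ‖x - x₀‖ := (le_max_right _ _).trans_lt hx
  have h3 : ‖x - x₀‖ - ‖x₀ - z‖ ≤ ‖x - z‖ := by
    have := norm_sub_le (x - z) (x₀ - z)
    rw [sub_sub_sub_cancel_right] at this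
    linarith
  have h0 := norm_nonneg (x₀ - z)
  have h4 : (‖x - x₀‖ - ‖x₀ - z‖) ^ 2 ≤ ‖x - z‖ ^ 2 := pow_le_pow_left₀ (by linarith) h3 2
  simp only [hr, hs]
  norm_cast
  nlinarith

theorem isProx_prox {n : ℕ} {ψ : E n → EReal} (hψ : IsProperLscConvex ψ) (z : E n) :
    IsProx ψ z (prox ψ z) :=
  Classical.epsilon_spec (exists_isProx hψ z)

theorem measurable_prox {n : ℕ} {ψ : E n → EReal} (hψ : IsProperLscConvex ψ) :
    Measurable (prox ψ) :=
  (LipschitzWith.of_dist_le_mul (K := 1) fun z w => by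
    simpa [dist_eq_norm] using
      (isProx_prox hψ z).norm_sub_le hψ (isProx_prox hψ w)).continuous.measurable

theorem IsProperLscConvex.const_mul {n : ℕ} {ψ : E n → EReal} (hψ : IsProperLscConvex ψ)
    {c : ℝ} (hc : 0 < c) : IsProperLscConvex fun x => (c : EReal) * ψ x where
  ne_bot x := by
    rw [Ne, EReal.mul_eq_bot]
    simp [hψ.ne_bot x, hc.not_gt]
  dom_nonempty := by
    obtain ⟨x, hx⟩ := hψ.dom_nonempty
    refine ⟨x, ?_⟩
    change (c : EReal) * ψ x < ⊤
    rw [lt_top_iff_ne_top, Ne, EReal.mul_eq_top]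
    have hx' : ψ x ≠ ⊤ := ne_of_lt (show ψ x < ⊤ from hx)
    simp [hx', hψ.ne_bot x, hc.not_gt]
  lsc := by
    refine Continuous.comp_lowerSemicontinuous (g := fun y : EReal => (c : EReal) * y) ?_ hψ.lsc ?_
    · refine continuous_iff_continuousAt.2 fun y => ?_
      refine EReal.Tendsto.const_mul Filter.tendsto_id ?_ ?_
      all_goals simp
    · intro x y hxy
      exact mul_le_mul_of_nonneg_left hxy (by exact_mod_cast hc.le)
  convex x y a b ha hb hab := by
    have h1 := mul_le_mul_of_nonneg_left (hψ.convex x y a b ha hb hab)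
      (show (0 : EReal) ≤ (c : EReal) by exact_mod_cast hc.le)
    rw [EReal.left_distrib_of_nonneg_of_ne_top (by exact_mod_cast hc.le) (EReal.coe_ne_top c)] at h1
    simp only [mul_left_comm (c : EReal)] at h1
    exact h1

/-! ### Clipping -/

theorem ballFun_isProperLscConvex {n : ℕ} {C : ℝ} (hC : 0 ≤ C) :
    IsProperLscConvex (ballFun (n := n) C) where
  ne_bot x := by
    unfold ballFun
    split_ifs
    · exact EReal.coe_ne_bot 1
    · exact top_ne_bot
  dom_nonempty := ⟨0, by simp [dom, ballFun, hC, ← EReal.coe_one, EReal.coe_lt_top]⟩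
  lsc := by
    rw [lowerSemicontinuous_iff_isClosed_preimage]
    intro y
    by_cases h1 : (1 : EReal) ≤ y
    · by_cases h2 : y = ⊤
      · simp [h2]
      · suffices h : ballFun C ⁻¹' Set.Iic y = Metric.closedBall (0 : E n) C from
          h ▸ Metric.isClosed_closedBall
        ext x
        rw [Set.mem_preimage, Set.mem_Iic, mem_closedBall_zero_iff]
        unfold ballFun
        split_ifs with h <;> simp [h, h1, h2]
    · suffices h : ballFun (n := n) C ⁻¹' Set.Iic y = ∅ from h ▸ isClosed_empty
      ext x
      rw [Set.mem_preimage, Set.mem_Iic, Set.mem_empty_iff_false, iff_false]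
      unfold ballFun
      split_ifs
      · exact h1
      · rw [top_le_iff]
        rintro rfl
        exact h1 le_top
  convex x y a b ha hb hab := by
    by_cases hx : ‖x‖ ≤ C
    · by_cases hy : ‖y‖ ≤ C
      · have : ‖a • x + b • y‖ ≤ C := by
          refine (norm_add_le _ _).trans ?_
          rw [norm_smul, norm_smul, Real.norm_of_nonneg ha.le, Real.norm_of_nonneg hb.le]
          calc a * ‖x‖ + b * ‖y‖ ≤ a * C + b * C := by gcongr
            _ = C := by rw [← add_mul, hab, one_mul]
        simp only [ballFun, this, hx, hy, if_true, mul_one]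
        rw [← EReal.coe_add, hab, EReal.coe_one]
      · simp [ballFun, hx, hy, EReal.coe_mul_top_of_pos hb]
    · have h1 : (a : EReal) * ballFun C x = ⊤ := by
        simp [ballFun, hx, EReal.coe_mul_top_of_pos ha]
      have h2 : (b : EReal) * ballFun C y ≠ ⊥ := by
        unfold ballFun
        split_ifs
        · simp
        · simp [EReal.coe_mul_top_of_pos hb]
      rw [h1, EReal.top_add_of_ne_bot h2]
      exact le_top

theorem norm_clip_le {n : ℕ} {C : ℝ} (hC : 0 ≤ C) (y : E n) : ‖clip C y‖ ≤ C := by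
  have hball := ballFun_isProperLscConvex (n := n) hC
  obtain ⟨r, hr⟩ := (isProx_prox hball y).exists_coe hball
  change ballFun C (clip C y) = r at hr
  by_contra hcon
  simp [ballFun, hcon] at hr

theorem measurable_clip {n : ℕ} {C : ℝ} (hC : 0 ≤ C) : Measurable (clip (n := n) C) :=
  measurable_prox (ballFun_isProperLscConvex hC)

/-- The Fréchet derivative of an arbitrary function is measurable, being zero by convention where
the function is not differentiable. -/
theorem measurable_gradient {n : ℕ} (f : E n → ℝ) : Measurable (gradient f) :=
  (InnerProductSpace.toDual ℝ (E n)).symm.continuous.measurable.comp (measurable_fderiv ℝ f)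

theorem measurable_avgClippedGrad {n k : ℕ} (f : Fin k → E n → ℝ) (b : ℕ) {C : ℝ} (hC : 0 ≤ C)
    (t : ℕ) : Measurable (avgClippedGrad f b C t) := by
  unfold avgClippedGrad
  have h : Measurable fun x => ∑ i ∈ batch k b t, clip C (gradient (f i) x) :=
    Finset.measurable_fun_sum _ fun i _ => (measurable_clip hC).comp (measurable_gradient _)
  exact h.const_smul (1 / (b : ℝ))

theorem card_batch_le (k b t : ℕ) : (batch k b t).card ≤ b := by
  have h : (batch k b t).map Fin.valEmbedding ⊆
      Finset.Ico (b * (t - 1) % k) (b * (t - 1) % k + b) := by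
    intro i hi
    simp only [batch, Finset.mem_map, Finset.mem_filter, Finset.mem_univ, true_and,
      Fin.valEmbedding_apply] at hi
    obtain ⟨j, hj, rfl⟩ := hi
    rw [Finset.mem_Ico]
    omega
  simpa using Finset.card_le_card h

theorem norm_avgClippedGrad_le {n k : ℕ} (f : Fin k → E n → ℝ) {b : ℕ} (hb : 1 ≤ b) {C : ℝ}
    (hC : 0 ≤ C) (t : ℕ) (x : E n) : ‖avgClippedGrad f b C t x‖ ≤ C := by
  have hb' : (0 : ℝ) < b := by exact_mod_cast hb
  have hsum : ‖∑ i ∈ batch k b t, clip C (gradient (f i) x)‖ ≤ b * C := by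
    refine (norm_sum_le_of_le _ fun i _ => norm_clip_le hC _).trans ?_
    rw [Finset.sum_const, nsmul_eq_mul]
    have : ((batch k b t).card : ℝ) ≤ b := by exact_mod_cast card_batch_le k b t
    gcongr
  unfold avgClippedGrad
  rw [norm_smul, Real.norm_of_nonneg (by positivity), one_div, inv_mul_le_iff₀ hb']
  exact hsum

/-! ### Rényi moments and data processing -/

/-- `μ` has a density with respect to `ν` whose moment of order `α` is at most `c`. -/
def RenyiMomentLE {X : Type*} [MeasurableSpace X] (α : ℝ) (μ ν : Measure X) (c : ℝ≥0∞) : Prop :=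
  ∃ g : X → ℝ≥0∞, Measurable g ∧ μ = ν.withDensity g ∧ ∫⁻ x, g x ^ α ∂ν ≤ c

/-- Absorbs the factor `A ^ (1 / q)` left by Hölder's inequality; the division needs `A` finite. -/
theorem le_of_le_rpow_mul_rpow {A c : ℝ≥0∞} (hA : A ≠ ∞) {p q : ℝ} (hpq : p.HolderConjugate q)
    (h : A ≤ c ^ (1 / p) * A ^ (1 / q)) : A ≤ c := by
  rcases eq_or_ne A 0 with rfl | h0
  · exact zero_le
  have hne0 : A ^ (1 / q) ≠ 0 := by
    simp [ENNReal.rpow_eq_zero_iff, h0, hA]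
  have hnet : A ^ (1 / q) ≠ ∞ := ENNReal.rpow_ne_top_of_nonneg (by
    have := hpq.symm.pos; positivity) hA
  have hsplit : A = A ^ (1 / p) * A ^ (1 / q) := by
    rw [← ENNReal.rpow_add _ _ h0 hA, one_div, one_div, hpq.inv_add_inv_eq_one, ENNReal.rpow_one]
  nth_rw 1 [hsplit] at h
  have h2 := (ENNReal.mul_le_mul_iff_left hne0 hnet).1 h
  have hp := hpq.pos
  exact (ENNReal.rpow_le_rpow_iff (by positivity)).1 h2

/-- Data processing: pushing forward does not increase Rényi moments. -/
theorem RenyiMomentLE.map {X Y : Type*} [MeasurableSpace X] [MeasurableSpace Y] {α : ℝ}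
    (hα : 1 < α) {μ ν : Measure X} [IsFiniteMeasure μ] [IsFiniteMeasure ν] {c : ℝ≥0∞}
    (h : RenyiMomentLE α μ ν c) {G : X → Y} (hG : Measurable G) :
    RenyiMomentLE α (μ.map G) (ν.map G) c := by
  obtain ⟨g, hg, hμ, hc⟩ := h
  have hac : μ.map G ≪ ν.map G := by
    refine Measure.AbsolutelyContinuous.map ?_ hG
    rw [hμ]
    exact withDensity_absolutelyContinuous _ _
  set r := (μ.map G).rnDeriv (ν.map G) with hr
  have hrm : Measurable r := Measure.measurable_rnDeriv _ _
  have hwd : (ν.map G).withDensity r = μ.map G := Measure.withDensity_rnDeriv_eq _ _ hac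
  have hpq : α.HolderConjugate (α / (α - 1)) := Real.HolderConjugate.conjExponent hα
  have hα1 : 0 < α - 1 := by linarith
  -- Truncation makes the moment finite, so Hölder's inequality can be absorbed. One factor `m` is
  -- bounded by `r`, which turns the integral into one against `μ`, hence against `g` on `X`.
  -- Monotone convergence then removes `M`.
  have htrunc : ∀ M : ℕ, ∫⁻ y, (min (r y) M) ^ α ∂(ν.map G) ≤ c := by
    intro M
    set m : Y → ℝ≥0∞ := fun y => min (r y) M with hm
    have hmm : Measurable m := hrm.min measurable_const
    have hfin : ∫⁻ y, m y ^ α ∂(ν.map G) ≠ ∞ := by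
      refine ne_top_of_le_ne_top (b := ∫⁻ _, (M : ℝ≥0∞) ^ α ∂(ν.map G)) ?_
        (lintegral_mono fun y => ?_)
      · rw [lintegral_const]
        exact ENNReal.mul_ne_top (ENNReal.rpow_ne_top_of_nonneg (by linarith)
          (ENNReal.natCast_ne_top M)) (measure_ne_top _ _)
      · exact ENNReal.rpow_le_rpow (min_le_right _ _) (by linarith)
    refine le_of_le_rpow_mul_rpow hfin hpq ?_
    calc ∫⁻ y, m y ^ α ∂(ν.map G)
        ≤ ∫⁻ y, r y * m y ^ (α - 1) ∂(ν.map G) := by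
          refine lintegral_mono fun y => ?_
          have : m y ^ α = m y * m y ^ (α - 1) := by
            nth_rw 2 [← ENNReal.rpow_one (m y)]
            rw [← ENNReal.rpow_add_of_nonneg _ _ zero_le_one hα1.le]
            congr 1
            ring
          rw [this]
          gcongr
          exact min_le_left _ _
      _ = ∫⁻ y, m y ^ (α - 1) ∂(μ.map G) := by
          rw [← hwd, lintegral_withDensity_eq_lintegral_mul _ hrm (hmm.pow_const _)]
          rfl
      _ = ∫⁻ x, g x * m (G x) ^ (α - 1) ∂ν := by
          rw [lintegral_map (hmm.pow_const _) hG, hμ,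
            lintegral_withDensity_eq_lintegral_mul _ hg
              (show Measurable fun x => m (G x) ^ (α - 1) from (hmm.comp hG).pow_const _)]
          rfl
      _ ≤ (∫⁻ x, g x ^ α ∂ν) ^ (1 / α) *
          (∫⁻ x, (m (G x) ^ (α - 1)) ^ (α / (α - 1)) ∂ν) ^ (1 / (α / (α - 1))) :=
          ENNReal.lintegral_mul_le_Lp_mul_Lq ν hpq hg.aemeasurable
            ((hmm.comp hG).pow_const _).aemeasurable
      _ ≤ c ^ (1 / α) * (∫⁻ y, m y ^ α ∂(ν.map G)) ^ (1 / (α / (α - 1))) := by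
          rw [lintegral_map (hmm.pow_const _) hG]
          simp_rw [← ENNReal.rpow_mul, mul_div_cancel₀ α hα1.ne']
          gcongr
  refine ⟨r, hrm, hwd.symm, ?_⟩
  refine le_of_tendsto' (lintegral_tendsto_of_tendsto_of_monotone
    (f := fun (M : ℕ) y => (min (r y) M) ^ α) (F := fun y => r y ^ α)
    (fun M => ((hrm.min measurable_const).pow_const _).aemeasurable) ?_ ?_) htrunc
  · refine Filter.Eventually.of_forall fun y M M' hMM' => ?_
    refine ENNReal.rpow_le_rpow (min_le_min_left _ ?_) (by linarith)
    exact_mod_cast hMM'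
  · refine Filter.Eventually.of_forall fun y => ?_
    refine ((ENNReal.continuous_rpow_const (y := α)).tendsto _).comp ?_
    simpa using (tendsto_const_nhds (x := r y)).min ENNReal.tendsto_nat_nhds_top

theorem RenyiMomentLE.renyiDiv_le {X : Type*} [MeasurableSpace X] {α : ℝ} (hα : 1 < α)
    {μ ν : Measure X} [IsFiniteMeasure ν] {y : ℝ}
    (h : RenyiMomentLE α μ ν (ENNReal.ofReal (Real.exp ((α - 1) * y)))) :
    renyiDiv α μ ν ≤ y := by
  obtain ⟨g, hg, rfl, hc⟩ := h
  have hα1 : 0 < α - 1 := by linarith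
  rw [renyiDiv, if_pos (withDensity_absolutelyContinuous _ _)]
  have h1 : ∫⁻ x, ((ν.withDensity g).rnDeriv ν x) ^ α ∂ν = ∫⁻ x, g x ^ α ∂ν := by
    refine lintegral_congr_ae ?_
    filter_upwards [Measure.rnDeriv_withDensity ν hg] with x hx
    rw [hx]
  have h2 := ENNReal.log_le_log hc
  rw [ENNReal.log_ofReal_of_pos (Real.exp_pos _), Real.log_exp] at h2
  rw [h1]
  calc ((1 / (α - 1) : ℝ) : EReal) * ENNReal.log (∫⁻ x, g x ^ α ∂ν)
      ≤ ((1 / (α - 1) : ℝ) : EReal) * (((α - 1) * y : ℝ) : EReal) :=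
        mul_le_mul_of_nonneg_left h2 (by exact_mod_cast (one_div_pos.2 hα1).le)
    _ = y := by
        rw [← EReal.coe_mul]
        congr 1
        field_simp

/-! ### Isotropic Gaussian noise -/

/-- The isotropic Gaussian law with standard deviation `σ`. -/
noncomputable def gaussianNoise (n : ℕ) (σ : ℝ) : Measure (E n) :=
  multivariateGaussian 0 (σ ^ 2 • (1 : Matrix (Fin n) (Fin n) ℝ))

instance (n : ℕ) (σ : ℝ) : IsProbabilityMeasure (gaussianNoise n σ) :=
  inferInstanceAs (IsProbabilityMeasure (multivariateGaussian _ _))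

theorem map_inner_gaussianNoise (n : ℕ) (σ : ℝ) (u : E n) :
    (gaussianNoise n σ).map (fun x => ⟪u, x⟫) = gaussianReal 0 (σ ^ 2 * ‖u‖ ^ 2).toNNReal := by
  have hS : (σ ^ 2 • (1 : Matrix (Fin n) (Fin n) ℝ)).PosSemidef :=
    Matrix.PosSemidef.one.smul (sq_nonneg σ)
  refine Measure.ext_of_charFun ?_
  ext s
  rw [gaussianNoise, charFun_gaussianReal, charFun_apply_real, integral_map (by fun_prop) (by fun_prop)]
  have h := charFun_multivariateGaussian (μ := (0 : E n)) hS (s • u)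
  rw [charFun_apply] at h
  have h2 : ∀ x : E n, Complex.exp (s * (⟪u, x⟫ : ℝ) * Complex.I)
      = Complex.exp (⟪x, s • u⟫ * Complex.I) := by
    intro x
    rw [real_inner_smul_right, real_inner_comm]
    push_cast
    rfl
  simp_rw [h2, h]
  congr 1
  have h3 : (s • u).ofLp ⬝ᵥ (σ ^ 2 • (1 : Matrix (Fin n) (Fin n) ℝ)).mulVec (s • u).ofLp
      = σ ^ 2 * ‖u‖ ^ 2 * s ^ 2 := by
    rw [Matrix.smul_mulVec, Matrix.one_mulVec, dotProduct_smul, EuclideanSpace.real_norm_sq_eq]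
    simp only [dotProduct, WithLp.ofLp_smul, Pi.smul_apply, smul_eq_mul, Finset.mul_sum,
      Finset.sum_mul]
    exact Finset.sum_congr rfl fun i _ => by ring
  rw [h3, Real.coe_toNNReal _ (by positivity)]
  simp

theorem lintegral_exp_inner_gaussianNoise (n : ℕ) (σ : ℝ) (u : E n) :
    ∫⁻ x, ENNReal.ofReal (Real.exp ⟪u, x⟫) ∂(gaussianNoise n σ)
      = ENNReal.ofReal (Real.exp (σ ^ 2 * ‖u‖ ^ 2 / 2)) := by
  have h := mgf_gaussianReal (map_inner_gaussianNoise n σ u) 1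
  -- A nonintegrable exponential would have Bochner integral zero, so positivity yields
  -- integrability.
  have hpos : 0 < mgf (fun x => ⟪u, x⟫) (gaussianNoise n σ) 1 := h ▸ Real.exp_pos _
  have hint := mgf_pos_iff.1 hpos
  simp only [mgf, one_mul] at h hint
  rw [← ofReal_integral_eq_lintegral_ofReal hint
    (Filter.Eventually.of_forall fun _ => (Real.exp_pos _).le), h,
    Real.coe_toNNReal _ (by positivity)]
  congr 2
  ring

/-- A finite measure on `ℝⁿ` all of whose exponential moments are finite is determined by them. -/
theorem ext_of_lintegral_exp_inner {n : ℕ} {μ ν : Measure (E n)} [IsProbabilityMeasure μ]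
    [IsProbabilityMeasure ν]
    (hfin : ∀ u, ∫⁻ x, ENNReal.ofReal (Real.exp ⟪u, x⟫) ∂μ ≠ ∞)
    (h : ∀ u, ∫⁻ x, ENNReal.ofReal (Real.exp ⟪u, x⟫) ∂μ
      = ∫⁻ x, ENNReal.ofReal (Real.exp ⟪u, x⟫) ∂ν) : μ = ν := by
  refine Measure.ext_of_charFun ?_
  ext t
  have hint : ∀ s : ℝ, Integrable (fun x => Real.exp (s * ⟪t, x⟫)) μ := by
    intro s
    refine ⟨by fun_prop, ?_⟩
    rw [hasFiniteIntegral_iff_ofReal (Filter.Eventually.of_forall fun _ => (Real.exp_pos _).le)]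
    simpa [real_inner_smul_left] using (hfin (s • t)).lt_top
  have hmgf : mgf (fun x => ⟪t, x⟫) μ = mgf (fun x => ⟪t, x⟫) ν := by
    ext s
    simp only [mgf]
    rw [integral_eq_lintegral_of_nonneg_ae
        (Filter.Eventually.of_forall fun _ => (Real.exp_pos _).le) (by fun_prop),
      integral_eq_lintegral_of_nonneg_ae
        (Filter.Eventually.of_forall fun _ => (Real.exp_pos _).le) (by fun_prop)]
    have := h (s • t)
    simp only [real_inner_smul_left] at this
    rw [this]
  have hset : integrableExpSet (fun x => ⟪t, x⟫) μ = Set.univ :=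
    Set.eq_univ_of_forall hint
  -- Analytic continuation from the real line to `Complex.I` turns equal moment generating functions
  -- into equal characteristic functions.
  have hI := eqOn_complexMGF_of_mgf hmgf (x := Complex.I) (by simp [hset])
  simp only [complexMGF] at hI
  simp only [charFun_apply, real_inner_comm t]
  simpa only [mul_comm Complex.I] using hI

/-- The density of the isotropic Gaussian law shifted by `δ` with respect to the unshifted one. -/
noncomputable def shiftDensity {n : ℕ} (σ : ℝ) (δ x : E n) : ℝ≥0∞ :=
  ENNReal.ofReal (Real.exp (⟪δ, x⟫ / σ ^ 2 - ‖δ‖ ^ 2 / (2 * σ ^ 2)))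

theorem measurable_shiftDensity {X : Type*} [MeasurableSpace X] {n : ℕ} (σ : ℝ) {d u : X → E n}
    (hd : Measurable d) (hu : Measurable u) : Measurable fun x => shiftDensity σ (d x) (u x) := by
  unfold shiftDensity
  fun_prop

theorem lintegral_exp_affine_gaussianNoise (n : ℕ) (σ : ℝ) (u : E n) (a : ℝ) :
    ∫⁻ x, ENNReal.ofReal (Real.exp (⟪u, x⟫ + a)) ∂(gaussianNoise n σ)
      = ENNReal.ofReal (Real.exp (σ ^ 2 * ‖u‖ ^ 2 / 2 + a)) := by
  simp_rw [Real.exp_add, ENNReal.ofReal_mul (Real.exp_pos _).le]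
  rw [lintegral_mul_const _ (by fun_prop), lintegral_exp_inner_gaussianNoise]

/-- The `α`-th power is again the exponential of an affine function. With `α = 1` this gives total
mass one; for general `α` it is the privacy cost of a shift. -/
theorem lintegral_shiftDensity_rpow {n : ℕ} {σ : ℝ} (hσ : 0 < σ) (α : ℝ) (δ : E n) :
    ∫⁻ x, shiftDensity σ δ x ^ α ∂(gaussianNoise n σ)
      = ENNReal.ofReal (Real.exp (α * (α - 1) * ‖δ‖ ^ 2 / (2 * σ ^ 2))) := by
  have h : ∀ x : E n, shiftDensity σ δ x ^ α
      = ENNReal.ofReal (Real.exp (⟪(α / σ ^ 2) • δ, x⟫ + -(α * ‖δ‖ ^ 2 / (2 * σ ^ 2)))) := by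
    intro x
    rw [shiftDensity, ENNReal.ofReal_rpow_of_pos (Real.exp_pos _), ← Real.exp_mul,
      real_inner_smul_left]
    congr 2
    ring
  simp_rw [h]
  rw [lintegral_exp_affine_gaussianNoise, norm_smul, mul_pow, Real.norm_eq_abs, sq_abs]
  congr 2
  field_simp
  ring

/-- Cameron–Martin formula for isotropic Gaussian laws. -/
theorem map_add_gaussianNoise {n : ℕ} {σ : ℝ} (hσ : 0 < σ) (δ : E n) :
    (gaussianNoise n σ).map (fun x => x + δ)
      = (gaussianNoise n σ).withDensity (shiftDensity σ δ) := by
  have hm := measurable_shiftDensity σ (measurable_const (a := δ)) measurable_id'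
  have : IsProbabilityMeasure ((gaussianNoise n σ).map (fun x => x + δ)) :=
    Measure.isProbabilityMeasure_map (by fun_prop)
  have : IsProbabilityMeasure ((gaussianNoise n σ).withDensity (shiftDensity σ δ)) := by
    refine ⟨?_⟩
    rw [withDensity_apply _ MeasurableSet.univ, Measure.restrict_univ]
    simpa using lintegral_shiftDensity_rpow hσ 1 δ
  have h1 : ∀ u : E n, ∫⁻ x, ENNReal.ofReal (Real.exp ⟪u, x⟫)
      ∂((gaussianNoise n σ).map (fun x => x + δ))
      = ENNReal.ofReal (Real.exp (σ ^ 2 * ‖u‖ ^ 2 / 2 + ⟪u, δ⟫)) := by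
    intro u
    rw [lintegral_map (by fun_prop) (by fun_prop)]
    simp_rw [inner_add_right]
    exact lintegral_exp_affine_gaussianNoise n σ u _
  refine ext_of_lintegral_exp_inner (fun u => by rw [h1]; exact ENNReal.ofReal_ne_top) fun u => ?_
  rw [h1, lintegral_withDensity_eq_lintegral_mul _ hm (by fun_prop)]
  have h2 : ∀ x : E n, (shiftDensity σ δ * fun x => ENNReal.ofReal (Real.exp ⟪u, x⟫)) x
      = ENNReal.ofReal (Real.exp (⟪u + (1 / σ ^ 2) • δ, x⟫ + -(‖δ‖ ^ 2 / (2 * σ ^ 2)))) := by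
    intro x
    rw [Pi.mul_apply, shiftDensity, ← ENNReal.ofReal_mul (Real.exp_pos _).le, ← Real.exp_add,
      inner_add_left, real_inner_smul_left]
    congr 2
    ring
  simp_rw [h2]
  rw [lintegral_exp_affine_gaussianNoise, norm_add_sq_real, norm_smul, mul_pow, Real.norm_eq_abs,
    sq_abs, real_inner_smul_right]
  congr 2
  field_simp
  ring

/-! ### One noisy step, and composition -/

/-- If the second coordinate of a product law is transformed, given the first coordinate, by a map
whose Rényi moment is at most `K`, then the Rényi moment is multiplied by at most `K`. -/
theorem RenyiMomentLE.prod_map {X Y : Type*} [MeasurableSpace X] [MeasurableSpace Y] {α : ℝ}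
    (hα : 1 < α) {μ ν : Measure X} [IsFiniteMeasure μ] [IsFiniteMeasure ν] {γ : Measure Y}
    [IsFiniteMeasure γ] {c K : ℝ≥0∞} (h : RenyiMomentLE α μ ν c) {S : X → Y → Y}
    {ρ : X → Y → ℝ≥0∞} (hS : Measurable fun p : X × Y => S p.1 p.2)
    (hρ : Measurable fun p : X × Y => ρ p.1 p.2)
    (hγ : ∀ x, γ.map (S x) = γ.withDensity (ρ x)) (hK : ∀ x, ∫⁻ y, ρ x y ^ α ∂γ ≤ K) :
    RenyiMomentLE α ((μ.prod γ).map fun p => (p.1, S p.1 p.2)) (ν.prod γ) (c * K) := by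
  obtain ⟨g, hg, hμ, hc⟩ := h
  have hα0 : 0 ≤ α := by linarith
  have hS' : Measurable fun p : X × Y => (p.1, S p.1 p.2) := measurable_fst.prodMk hS
  have hSx : ∀ x, Measurable (S x) := fun x => hS.comp measurable_prodMk_left
  have hρx : ∀ x, Measurable (ρ x) := fun x => hρ.comp measurable_prodMk_left
  have hgρ : Measurable fun p : X × Y => g p.1 * ρ p.1 p.2 := (hg.comp measurable_fst).mul hρ
  refine ⟨fun p => g p.1 * ρ p.1 p.2, hgρ, ?_, ?_⟩
  · refine Measure.ext_of_lintegral _ fun f hf => ?_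
    have hfS : Measurable fun p : X × Y => f (p.1, S p.1 p.2) := hf.comp hS'
    rw [lintegral_map hf hS', lintegral_prod _ hfS.aemeasurable,
      lintegral_withDensity_eq_lintegral_mul _ hgρ hf,
      lintegral_prod _ (hgρ.mul hf).aemeasurable, hμ,
      lintegral_withDensity_eq_lintegral_mul _ hg hfS.lintegral_prod_right']
    -- With the first coordinate fixed, the claim is the change of variables `hγ` tested against `f
    -- (x, ·)`.
    refine lintegral_congr fun x => ?_
    have hfx : Measurable fun y => f (x, y) := hf.comp measurable_prodMk_left
    have h1 : ∫⁻ y, f (x, S x y) ∂γ = ∫⁻ y, ρ x y * f (x, y) ∂γ := by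
      rw [← lintegral_map (f := fun y => f (x, y)) hfx (hSx x), hγ,
        lintegral_withDensity_eq_lintegral_mul _ (hρx x) hfx]
      rfl
    simp only [Pi.mul_apply]
    simp only [mul_assoc]
    rw [h1, lintegral_const_mul _ (by fun_prop)]
  · rw [lintegral_prod _ (hgρ.pow_const α).aemeasurable]
    simp_rw [ENNReal.mul_rpow_of_nonneg _ _ hα0]
    calc ∫⁻ x, ∫⁻ y, g x ^ α * ρ x y ^ α ∂γ ∂ν
        ≤ ∫⁻ x, g x ^ α * K ∂ν := by
          refine lintegral_mono fun x => ?_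
          rw [lintegral_const_mul _ ((hρx x).pow_const _)]
          gcongr
          exact hK x
      _ ≤ c * K := by
          rw [lintegral_mul_const _ (hg.pow_const _)]
          gcongr

/-- The drift difference is moved into the noise: `φ x + y = φ' x + (y + (φ x - φ' x))`. Both output
laws thus become images under the same map, of a pair with shifted noise and of a pair with plain
noise, and data processing applies. -/
theorem RenyiMomentLE.noisyStep {n : ℕ} {α σ : ℝ} (hα : 1 < α) (hσ : 0 < σ)
    {μ ν : Measure (E n)} [IsProbabilityMeasure μ] [IsProbabilityMeasure ν] {c : ℝ≥0∞}
    (h : RenyiMomentLE α μ ν c) {φ φ' G : E n → E n} (hφ : Measurable φ) (hφ' : Measurable φ')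
    (hG : Measurable G) {D : ℝ} (hD : ∀ x, ‖φ x - φ' x‖ ≤ D) :
    RenyiMomentLE α ((μ.prod (gaussianNoise n σ)).map fun p => G (φ p.1 + p.2))
      ((ν.prod (gaussianNoise n σ)).map fun p => G (φ' p.1 + p.2))
      (c * ENNReal.ofReal (Real.exp (α * (α - 1) * D ^ 2 / (2 * σ ^ 2)))) := by
  have hα1 : 0 < α - 1 := by linarith
  have hδ : Measurable fun p : E n × E n => φ p.1 - φ' p.1 :=
    (hφ.comp measurable_fst).sub (hφ'.comp measurable_fst)
  have hS : Measurable fun p : E n × E n => p.2 + (φ p.1 - φ' p.1) := measurable_snd.add hδ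
  have hρ : Measurable fun p : E n × E n => shiftDensity σ (φ p.1 - φ' p.1) p.2 :=
    measurable_shiftDensity σ hδ measurable_snd
  have hbound : ∀ x, ∫⁻ y, shiftDensity σ (φ x - φ' x) y ^ α ∂(gaussianNoise n σ)
      ≤ ENNReal.ofReal (Real.exp (α * (α - 1) * D ^ 2 / (2 * σ ^ 2))) := by
    intro x
    rw [lintegral_shiftDensity_rpow hσ]
    have hsq : ‖φ x - φ' x‖ ^ 2 ≤ D ^ 2 := pow_le_pow_left₀ (norm_nonneg _) (hD x) 2
    have hαα : 0 ≤ α * (α - 1) := by positivity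
    refine ENNReal.ofReal_le_ofReal (Real.exp_le_exp.2 ?_)
    exact div_le_div_of_nonneg_right (mul_le_mul_of_nonneg_left hsq hαα) (by positivity)
  have hmom := h.prod_map hα (S := fun x y => y + (φ x - φ' x)) hS hρ
    (fun x => map_add_gaussianNoise hσ _) hbound
  have hS' : Measurable fun p : E n × E n => (p.1, p.2 + (φ p.1 - φ' p.1)) :=
    measurable_fst.prodMk hS
  have : IsProbabilityMeasure
      ((μ.prod (gaussianNoise n σ)).map fun p => (p.1, p.2 + (φ p.1 - φ' p.1))) :=
    Measure.isProbabilityMeasure_map hS'.aemeasurable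
  have hK : Measurable fun p : E n × E n => G (φ' p.1 + p.2) :=
    hG.comp ((hφ'.comp measurable_fst).add measurable_snd)
  have h2 := hmom.map hα hK
  rw [Measure.map_map hK hS'] at h2
  have h3 : ((fun p : E n × E n => G (φ' p.1 + p.2)) ∘
      fun p : E n × E n => (p.1, p.2 + (φ p.1 - φ' p.1))) = fun p => G (φ p.1 + p.2) := by
    funext p
    simp only [Function.comp_apply]
    congr 1
    abel
  rwa [h3] at h2

/-! ### The iterates -/

section Iterates

variable {n k : ℕ} (f : Fin k → E n → ℝ) (h : E n → EReal) (b : ℕ) (lam C : ℝ) (x₀ : E n)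

theorem iterate_congr {N N' : ℕ → E n} {t : ℕ} (hNN' : ∀ s ≤ t, N s = N' s) :
    iterate f h b lam C x₀ N t = iterate f h b lam C x₀ N' t := by
  induction t with
  | zero => rfl
  | succ t ih =>
    simp only [iterate]
    rw [ih fun s hs => hNN' s (hs.trans t.le_succ), hNN' (t + 1) le_rfl]

variable {h lam C}

theorem measurable_iterate (hh : IsProperLscConvex h) (hlam : 0 < lam) (hC : 0 ≤ C) (t : ℕ) :
    Measurable fun N : ℕ → E n => iterate f h b lam C x₀ N t := by
  induction t with
  | zero => exact measurable_const
  | succ t ih =>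
    have hg := (measurable_avgClippedGrad f b hC (t + 1)).comp ih
    exact (measurable_prox (hh.const_mul hlam)).comp
      ((ih.sub (hg.const_smul lam)).add (measurable_pi_apply (t + 1)))

variable {Ω : Type*} [MeasurableSpace Ω] {P : Measure Ω}

theorem indepFun_iterate_noise (hh : IsProperLscConvex h) (hlam : 0 < lam) (hC : 0 ≤ C)
    {N : ℕ → Ω → E n} (hNm : ∀ t, Measurable (N t)) (hN : iIndepFun N P) (t : ℕ) :
    IndepFun (fun ω => iterate f h b lam C x₀ (fun s => N s ω) t) (N (t + 1)) P := by
  have hind := hN.indepFun_finset (Finset.range (t + 1)) {t + 1} (by simp) hNm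
  -- Padding by zero exhibits the iterate at time `t` as a measurable function of the noises up to
  -- index `t` alone.
  let ext : (Finset.range (t + 1) → E n) → ℕ → E n := fun v s =>
    if hs : s ∈ Finset.range (t + 1) then v ⟨s, hs⟩ else 0
  have hext : Measurable ext := by
    refine measurable_pi_lambda _ fun s => ?_
    by_cases hs : s ∈ Finset.range (t + 1)
    · simp only [ext, dif_pos hs]
      exact measurable_pi_apply _
    · simp only [ext, dif_neg hs]
      exact measurable_const
  have hlast : Measurable fun v : ({t + 1} : Finset ℕ) → E n =>
      v ⟨t + 1, Finset.mem_singleton_self _⟩ := measurable_pi_apply _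
  have h1 := hind.comp ((measurable_iterate f b x₀ hh hlam hC t).comp hext) hlast
  have h2 : (fun ω => iterate f h b lam C x₀ (fun s => N s ω) t)
      = ((fun N => iterate f h b lam C x₀ N t) ∘ ext) ∘
        fun ω (s : Finset.range (t + 1)) => N s ω := by
    funext ω
    refine iterate_congr f h b lam C x₀ fun s hs => ?_
    simp only [ext, dif_pos (Finset.mem_range.2 (Nat.lt_succ_of_le hs))]
  rw [h2]
  exact h1

variable [IsProbabilityMeasure P]

theorem map_iterate_succ (hh : IsProperLscConvex h) (hlam : 0 < lam) (hC : 0 ≤ C) {σ : ℝ}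
    {N : ℕ → Ω → E n} (hNm : ∀ t, Measurable (N t)) (hN : iIndepFun N P)
    (hlaw : ∀ t, P.map (N t) = gaussianNoise n σ) (t : ℕ) :
    P.map (fun ω => iterate f h b lam C x₀ (fun s => N s ω) (t + 1))
      = ((P.map fun ω => iterate f h b lam C x₀ (fun s => N s ω) t).prod (gaussianNoise n σ)).map
        fun p => prox (fun x => (lam : EReal) * h x)
          ((p.1 - lam • avgClippedGrad f b C (t + 1) p.1) + p.2) := by
  have hX : Measurable fun ω => iterate f h b lam C x₀ (fun s => N s ω) t :=
    (measurable_iterate f b x₀ hh hlam hC t).comp (measurable_pi_lambda _ hNm)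
  have hprod := (indepFun_iff_map_prod_eq_prod_map_map hX.aemeasurable
    (hNm (t + 1)).aemeasurable).1 (indepFun_iterate_noise f b x₀ hh hlam hC hNm hN t)
  have hg := measurable_avgClippedGrad f b hC (t + 1)
  have hstep : Measurable fun p : E n × E n => prox (fun x => (lam : EReal) * h x)
      ((p.1 - lam • avgClippedGrad f b C (t + 1) p.1) + p.2) :=
    (measurable_prox (hh.const_mul hlam)).comp
      ((measurable_fst.sub ((hg.comp measurable_fst).const_smul lam)).add measurable_snd)
  rw [← hlaw (t + 1), ← hprod, Measure.map_map hstep (hX.prodMk (hNm (t + 1)))]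
  rfl

/-- Composition bound for two runs of DP-SGD along the same noise. -/
theorem renyiMomentLE_iterate (f' : Fin k → E n → ℝ) (hb : 1 ≤ b) (hh : IsProperLscConvex h)
    (hlam : 0 < lam) (hC : 0 ≤ C) {σ α : ℝ} (hσ : 0 < σ) (hα : 1 < α)
    {N : ℕ → Ω → E n} (hNm : ∀ t, Measurable (N t)) (hN : iIndepFun N P)
    (hlaw : ∀ t, P.map (N t) = gaussianNoise n σ) (t : ℕ) :
    RenyiMomentLE α (P.map fun ω => iterate f h b lam C x₀ (fun s => N s ω) t)
      (P.map fun ω => iterate f' h b lam C x₀ (fun s => N s ω) t)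
      (ENNReal.ofReal (Real.exp ((α - 1) * (2 * α * t * (lam * C / σ) ^ 2)))) := by
  induction t with
  | zero =>
    refine ⟨fun _ => 1, measurable_const, ?_, ?_⟩
    · simp [iterate]
    · simp [iterate]
  | succ t ih =>
    have hprob : ∀ e : Fin k → E n → ℝ,
        IsProbabilityMeasure (P.map fun ω => iterate e h b lam C x₀ (fun s => N s ω) t) :=
      fun e => Measure.isProbabilityMeasure_map
        ((measurable_iterate e b x₀ hh hlam hC t).comp (measurable_pi_lambda _ hNm)).aemeasurable
    have := hprob f
    have := hprob f'
    rw [map_iterate_succ f b x₀ hh hlam hC hNm hN hlaw,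
      map_iterate_succ f' b x₀ hh hlam hC hNm hN hlaw]
    have hmeas : ∀ e : Fin k → E n → ℝ,
        Measurable fun x => x - lam • avgClippedGrad e b C (t + 1) x := fun e =>
      measurable_id.sub ((measurable_avgClippedGrad e b hC (t + 1)).const_smul lam)
    have hstep := ih.noisyStep hα hσ (hmeas f) (hmeas f') (measurable_prox (hh.const_mul hlam))
      (D := 2 * lam * C) fun x => by
        have h1 := norm_avgClippedGrad_le f hb hC (t + 1) x
        have h2 := norm_avgClippedGrad_le f' hb hC (t + 1) x
        rw [sub_sub_sub_cancel_left, ← smul_sub, norm_smul, Real.norm_of_nonneg hlam.le]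
        have h3 := norm_sub_le (avgClippedGrad f' b C (t + 1) x) (avgClippedGrad f b C (t + 1) x)
        calc lam * ‖avgClippedGrad f' b C (t + 1) x - avgClippedGrad f b C (t + 1) x‖
            ≤ lam * (2 * C) := by gcongr; linarith
          _ = 2 * lam * C := by ring
    rw [← ENNReal.ofReal_mul (Real.exp_pos _).le, ← Real.exp_add] at hstep
    -- The new exponent matches because `α * (α - 1) * (2 * lam * C) ^ 2 / (2 * σ ^ 2)` equals `(α -
    -- 1) * (2 * α * (lam * C / σ) ^ 2)`.
    convert hstep using 3
    push_cast
    field_simp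

end Iterates

end DPSGD

theorem theorem4p1 {n k : ℕ} {Ω : Type*} [MeasurableSpace Ω] (P : Measure Ω)
    [IsProbabilityMeasure P]
    (h : DPSGD.E n → EReal) (hh : DPSGD.IsProperLscConvex h)
    (f f' : Fin k → DPSGD.E n → ℝ)
    (hf : ∀ i, ∀ x ∈ DPSGD.dom h, DifferentiableAt ℝ (f i) x)
    (hf' : ∀ i, ∀ x ∈ DPSGD.dom h, DifferentiableAt ℝ (f' i) x)
    (hff' : DPSGD.Neighboring f f')
    (b ℓ T : ℕ) (hb : 1 ≤ b) (hk : k = b * ℓ) (hT : ℓ ≤ T)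
    (lam C σ α : ℝ) (hlam : 0 < lam) (hC : 0 ≤ C) (hσ : 0 < σ) (hα : 1 < α)
    (x₀ : DPSGD.E n) (hx₀ : x₀ ∈ DPSGD.dom h)
    (N : ℕ → Ω → DPSGD.E n)
    (hN : ∀ t, HasLaw (N t)
      (multivariateGaussian 0 (σ ^ 2 • (1 : Matrix (Fin n) (Fin n) ℝ))) P)
    (hNindep : iIndepFun N P)
    (X X' : ℕ → Ω → DPSGD.E n)
    (hX : ∀ t ω, X t ω = DPSGD.iterate f h b lam C x₀ (fun s => N s ω) t)
    (hX' : ∀ t ω, X' t ω = DPSGD.iterate f' h b lam C x₀ (fun s => N s ω) t) :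
    AEMeasurable (X T) P ∧ AEMeasurable (X' T) P ∧
      DPSGD.renyiDiv α (P.map (X T)) (P.map (X' T))
        ≤ ((8 * α * (T : ℝ) * (lam * C / σ) ^ 2 : ℝ) : EReal) := by
  have hmk : ∀ t, AEMeasurable (N t) P := fun t => (hN t).aemeasurable
  -- `HasLaw` gives only a.e. measurability. Measurable versions of the countably many noises agree
  -- with them simultaneously off one null set, so the iterates change only there.
  set N' : ℕ → Ω → DPSGD.E n := fun t => (hmk t).mk (N t)
  have hNm : ∀ t, Measurable (N' t) := fun t => (hmk t).measurable_mk
  have hNN' : ∀ t, N t =ᵐ[P] N' t := fun t => (hmk t).ae_eq_mk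
  have hind : iIndepFun N' P := hNindep.congr hNN'
  have hlaw : ∀ t, P.map (N' t) = DPSGD.gaussianNoise n σ := fun t => by
    rw [← Measure.map_congr (hNN' t), (hN t).map_eq, DPSGD.gaussianNoise]
  have hmeas : ∀ e : Fin k → DPSGD.E n → ℝ,
      Measurable fun ω => DPSGD.iterate e h b lam C x₀ (fun s => N' s ω) T := fun e =>
    (DPSGD.measurable_iterate e b x₀ hh hlam hC T).comp (measurable_pi_lambda _ hNm)
  have hae : ∀ e : Fin k → DPSGD.E n → ℝ,
      (fun ω => DPSGD.iterate e h b lam C x₀ (fun s => N s ω) T)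
        =ᵐ[P] fun ω => DPSGD.iterate e h b lam C x₀ (fun s => N' s ω) T := fun e => by
    filter_upwards [ae_all_iff.2 hNN'] with ω hω
    exact DPSGD.iterate_congr e h b lam C x₀ fun s _ => hω s
  have hXT : X T =ᵐ[P] fun ω => DPSGD.iterate f h b lam C x₀ (fun s => N' s ω) T := by
    rw [show X T = _ from funext (hX T)]
    exact hae f
  have hXT' : X' T =ᵐ[P] fun ω => DPSGD.iterate f' h b lam C x₀ (fun s => N' s ω) T := by
    rw [show X' T = _ from funext (hX' T)]
    exact hae f'
  refine ⟨⟨_, hmeas f, hXT⟩, ⟨_, hmeas f', hXT'⟩, ?_⟩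
  rw [Measure.map_congr hXT, Measure.map_congr hXT']
  have : IsProbabilityMeasure
      (P.map fun ω => DPSGD.iterate f' h b lam C x₀ (fun s => N' s ω) T) :=
    Measure.isProbabilityMeasure_map (hmeas f').aemeasurable
  refine (DPSGD.RenyiMomentLE.renyiDiv_le hα (DPSGD.renyiMomentLE_iterate f b x₀ f' hb hh hlam hC
    hσ hα hNm hind hlaw T)).trans (EReal.coe_le_coe_iff.2 ?_)
  -- Only `2 ≤ 8` is left to compare.
  gcongr
  norm_num
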